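/- For integers $U,V\ge 1$ and a real image $x=(x[u,v])_{0\le u<U,\,0\le v<V}$ let $$\mathscr F(x)[k,l]=\frac1{UV}\sum_{u=0}^{U-1}\sum_{v=0}^{V-1}x[u,v]\,e^{-2\pi i\left(\frac{ku}{U}+\frac{lv}{V}\right)},\qquad 0\le k<U,\ 0\le l<V,$$ and call $a(x)[k,l]=\operatorname{Re}\mathscr F(x)[k,l]$ and $b(x)[k,l]=\operatorname{Im}\mathscr F(x)[k,l]$ the (real) Fourier coefficients of $x$. Let $*$ be circular convolution, $(h*\eta)[p]=\sum_q h[q]\,\eta[p-q]$, with positions taken modulo $(U,V)$. Let $\nu$ be a probability law on $\mathbb R$ with mean $0$ and finite variance $\sigma^2$. Let $(U_N,V_N)$ be image sizes with $U_NV_N\to\infty$, let $h_N$ be any real $U_N\times V_N$ kernel, let $\eta_N$ be a $U_N\times V_N$ field of i.i.d. random variables of law $\nu$, and let $n_N=h_N*\eta_N$. For a Fourier coefficient $X$ of $n_N$ put $\tilde X=(X-\mathbb E X)/\sqrt{\operatorname{Var}X}$ if $\operatorname{Var}X\neq0$, and $\tilde X=0$ otherwise. A coefficient of $n_N$ at $[k,l]$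 has nonzero variance if and only if $\sigma^2\ne0$, $\mathscr F(h_N)[k,l]\neq 0$, and it is not the imaginary coefficient at a frequency with $[2k,2l]\equiv[0,0]$ modulo $(U_N,V_N)$; a coefficient of variance zero (a degenerate Gaussian) is $0$ almost surely. Moreover: (i) If $X_N$ is, for each $N$, any Fourier coefficient of $n_N$ (its frequency and its part may depend on $N$), and $\operatorname{Var}X_N\ne0$ for all large $N$, then $\tilde X_N$ converges in distribution to $\mathcal N(0,1)$. (ii) Different Fourier coefficients become independent: let $X_N^{(1)},\dots,X_N^{(m)}$ be Fourier coefficients of $n_N$ such that, for all large $N$, no two of them are the same part (real or imaginary) at frequencies that are equal or are mirror images $[k,l]$, $[-k,-l]$ of each other modulo $(U_N,V_N)$ (such coefficients of a real image coincide up to sign). Suppose there is a set $D\subseteq\{1,\dots,m\}$ such that for all large $N$ one has $\operatorname{Var}X_N^{(i)}\neq0$ exactly for $i\in D$. Then $(\tilde X_N^{(1)},\dots,\tilde X_N^{(m)})$ converges in distribution to the product measure $\bigotimes_{i=1}^m\mathcal N(0,\mathbf 1_{i\in D})$, where $\mathcal N(0,0)=\delta_0$. -/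

import Mathlib

open MeasureTheory ProbabilityTheory Filter
open scoped NNReal

namespace FourierNoise

/-- Real images of size `U × V`, indexed by the positions `[u, v]` with `0 ≤ u < U`, `0 ≤ v < V`. -/
abbrev Image (U V : ℕ) : Type := Fin U × Fin V → ℝ

/-- The two-dimensional discrete Fourier transform with the normalization `1 / (U V)`. -/
noncomputable def dft {U V : ℕ} (x : Image U V) (k : Fin U) (l : Fin V) : ℂ :=
  (1 / ((U : ℂ) * (V : ℂ))) * ∑ u : Fin U, ∑ v : Fin V, (x (u, v) : ℂ) *
    Complex.exp (-(Complex.I * (2 * (Real.pi : ℂ) *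
      ((k : ℂ) * (u : ℂ) / (U : ℂ) + (l : ℂ) * (v : ℂ) / (V : ℂ)))))

/-- Circular convolution `h * η` of two images; the subtraction of positions is modulo `(U, V)`. -/
def conv {U V : ℕ} (h η : Image U V) : Image U V :=
  fun p => ∑ q : Fin U × Fin V, h q * η (p - q)

/-- Which of the two real coefficients of a complex Fourier coefficient is meant. -/
inductive Part where
  | re
  | im

/-- The name of a real Fourier coefficient: a frequency `[k, l]`, and real or imaginary part. -/
structure CoeffIndex (U V : ℕ) where
  k : Fin U
  l : Fin V
  part : Part

/-- The real coefficient `a(x)[k, l]` or the imaginary coefficient `b(x)[k, l]`. -/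
noncomputable def coeff {U V : ℕ} (x : Image U V) (c : CoeffIndex U V) : ℝ :=
  match c.part with
  | Part.re => (dft x c.k c.l).re
  | Part.im => (dft x c.k c.l).im

/-- The frequency `[k, l]` is its own mirror image `[-k, -l]` modulo `(U, V)`. -/
def CoeffIndex.SelfConj {U V : ℕ} (c : CoeffIndex U V) : Prop :=
  U ∣ 2 * (c.k : ℕ) ∧ V ∣ 2 * (c.l : ℕ)

/-- Two names denote the same coefficient of a real image, up to sign: they ask for the same part,
at frequencies which are equal or mirror images `[k, l]`, `[-k, -l]` of each other
(for real `x` one has `a(x)[-k, -l] = a(x)[k, l]` and `b(x)[-k, -l] = - b(x)[k, l]`). -/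
def CoeffIndex.SameUpToConj {U V : ℕ} (c d : CoeffIndex U V) : Prop :=
  c.part = d.part ∧
    ((c.k = d.k ∧ c.l = d.l) ∨ (U ∣ (c.k : ℕ) + (d.k : ℕ) ∧ V ∣ (c.l : ℕ) + (d.l : ℕ)))

/-- The coefficient `c` of the noise `n = h * η`, as a random variable. -/
noncomputable def noiseCoeff {Ω : Type*} {U V : ℕ} (h : Image U V)
    (η : Fin U × Fin V → Ω → ℝ) (c : CoeffIndex U V) (ω : Ω) : ℝ :=
  coeff (conv h (fun p => η p ω)) c

/-- The normalized random variable `(X - μ[X]) / σ[X]`; it is `0` if `σ[X] = 0`. -/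
noncomputable def standardize {Ω : Type*} [MeasurableSpace Ω] (P : Measure Ω) (X : Ω → ℝ)
    (ω : Ω) : ℝ :=
  (X ω - ∫ ω', X ω' ∂P) / Real.sqrt (variance X P)

end FourierNoise

/-!
Since a circular convolution becomes a product under the Fourier transform, every coefficient of
`h * η` is a linear form in the noise `η` whose weights are a plane wave `p ↦ Re (z ψ(p))`, for a
character `ψ` of the group of positions. Orthogonality of characters has two consequences. The
weights of two different coefficients are orthogonal, so these coefficients are uncorrelated; and
the square of each weight is at most `2 / (U V)` times the sum of the squares of all of them.
Hence no position contributes substantially to a standardized coefficient, the Lindeberg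
condition holds whatever the kernel `h` is, and the joint central limit theorem follows by
comparing characteristic functions with those of Gaussian variables, factor by factor.
-/

namespace FourierNoise

open Finset
open scoped Topology ComplexConjugate

section CharFun

lemma norm_prod_sub_prod_le {ι R : Type*} [NormedCommRing R] [NormOneClass R] (s : Finset ι)
    {z w : ι → R} (hz : ∀ i ∈ s, ‖z i‖ ≤ 1) (hw : ∀ i ∈ s, ‖w i‖ ≤ 1) :
    ‖∏ i ∈ s, z i - ∏ i ∈ s, w i‖ ≤ ∑ i ∈ s, ‖z i - w i‖ := by
  classical
  induction s using Finset.induction_on with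
  | empty => simp
  | insert a s ha ih =>
    rw [prod_insert ha, prod_insert ha, sum_insert ha]
    have hprod : ‖∏ i ∈ s, w i‖ ≤ 1 :=
      (s.norm_prod_le w).trans <| prod_le_one (fun _ _ ↦ norm_nonneg _)
        fun i hi ↦ hw i (mem_insert_of_mem hi)
    have hs := ih (fun i hi ↦ hz i (mem_insert_of_mem hi)) fun i hi ↦ hw i (mem_insert_of_mem hi)
    calc ‖z a * ∏ i ∈ s, z i - w a * ∏ i ∈ s, w i‖
        = ‖(z a - w a) * ∏ i ∈ s, w i + z a * (∏ i ∈ s, z i - ∏ i ∈ s, w i)‖ := by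
          congr 1; ring
      _ ≤ ‖z a - w a‖ * ‖∏ i ∈ s, w i‖ + ‖z a‖ * ‖∏ i ∈ s, z i - ∏ i ∈ s, w i‖ :=
          (norm_add_le _ _).trans (add_le_add (norm_mul_le _ _) (norm_mul_le _ _))
      _ ≤ ‖z a - w a‖ * 1 + 1 * ∑ i ∈ s, ‖z i - w i‖ := by
          gcongr
          exact hz a (mem_insert_self a s)
      _ = ‖z a - w a‖ + ∑ i ∈ s, ‖z i - w i‖ := by ring

lemma charFun_sub_charFun_isLittleO_pow {μ ν : Measure ℝ} [IsFiniteMeasure μ] [IsFiniteMeasure ν]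
    {n : ℕ} (hμ : MemLp id n μ) (hν : MemLp id n ν)
    (hmoment : ∀ k ≤ n, ∫ x, x ^ k ∂μ = ∫ x, x ^ k ∂ν) :
    (fun t ↦ charFun μ t - charFun ν t) =o[𝓝 0] fun t ↦ t ^ n := by
  have htaylor t : taylorWithinEval (charFun μ) n Set.univ 0 t =
      taylorWithinEval (charFun ν) n Set.univ 0 t := by
    rw [taylorWithinEval_charFun_zero hμ, taylorWithinEval_charFun_zero hν]
    refine sum_congr rfl fun k hk ↦ ?_
    rw [hmoment k (Nat.lt_succ_iff.1 (mem_range.1 hk))]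
  refine ((taylor_isLittleO_univ (x₀ := 0) (contDiff_charFun hμ)).sub
    (taylor_isLittleO_univ (contDiff_charFun hν))).congr (fun t ↦ ?_) fun t ↦ by rw [sub_zero]
  rw [htaylor, sub_sub_sub_cancel_right]

variable {ν : Measure ℝ} [IsProbabilityMeasure ν]

lemma charFun_sub_charFun_gaussianReal_isLittleO (hν2 : MemLp id 2 ν) (hν0 : ∫ x, x ∂ν = 0) :
    (fun t ↦ charFun ν t - charFun (gaussianReal 0 Var[id; ν].toNNReal) t)
      =o[𝓝 0] fun t ↦ Var[id; ν] * t ^ 2 := by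
  rcases eq_or_ne Var[id; ν] 0 with hvar | hvar
  · have hdirac : ν = Measure.dirac 0 := by
      have h0 : id =ᵐ[ν] fun _ ↦ 0 := by
        simpa [EventuallyEq, hν0] using ae_eq_integral_of_variance_eq_zero hν2 hvar
      simpa using Measure.map_congr h0
    simp [hdirac]
  · refine (Asymptotics.isLittleO_const_mul_right_iff hvar).2 <|
      charFun_sub_charFun_isLittleO_pow (by simpa using hν2)
        (by simpa using memLp_id_gaussianReal 2) fun k hk ↦ ?_
    have hsq : ∫ x, x ^ 2 ∂ν = ∫ x, x ^ 2 ∂gaussianReal 0 Var[id; ν].toNNReal := by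
      have hG := variance_of_integral_eq_zero aemeasurable_id
        (integral_id_gaussianReal (μ := 0) (v := Var[id; ν].toNNReal))
      rw [variance_id_gaussianReal, Real.coe_toNNReal _ (variance_nonneg _ _)] at hG
      exact (variance_of_integral_eq_zero aemeasurable_id hν0).symm.trans hG
    interval_cases k
    · simp
    · simp [hν0]
    · exact hsq

/-- The Lindeberg condition takes the form `‖a N‖ → 0` of the sup norm, since the summands are
multiples `a N p` of variables with one common law. -/
lemma tendsto_prod_charFun (hν2 : MemLp id 2 ν) (hν0 : ∫ x, x ∂ν = 0)
    {ι : ℕ → Type*} [∀ N, Fintype (ι N)] {a : ∀ N, ι N → ℝ} {s : ℝ}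
    (hs : Tendsto (fun N ↦ Var[id; ν] * (a N ⬝ᵥ a N)) atTop (𝓝 s))
    (ha : Tendsto (fun N ↦ ‖a N‖) atTop (𝓝 0)) :
    Tendsto (fun N ↦ ∏ p, charFun ν (a N p)) atTop (𝓝 (Complex.exp (-s / 2))) := by
  set γ := gaussianReal 0 Var[id; ν].toNNReal with hγ
  have hgauss N : ∏ p, charFun γ (a N p) =
      Complex.exp (-(Var[id; ν] * (a N ⬝ᵥ a N) : ℝ) / 2) := by
    simp only [hγ, charFun_gaussianReal, ← Complex.exp_sum,
      Real.coe_toNNReal _ (variance_nonneg _ _), dotProduct]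
    congr 1
    push_cast
    rw [mul_sum, ← sum_neg_distrib, sum_div]
    exact sum_congr rfl fun p _ ↦ by ring
  have hdiff : (fun N ↦ ∏ p, charFun ν (a N p) - ∏ p, charFun γ (a N p)) =o[atTop]
      fun N ↦ Var[id; ν] * (a N ⬝ᵥ a N) := by
    refine Asymptotics.isLittleO_iff.2 fun ε hε ↦ ?_
    obtain ⟨δ, hδ, hclose⟩ := Metric.eventually_nhds_iff.1 <|
      (charFun_sub_charFun_gaussianReal_isLittleO hν2 hν0).def hε
    filter_upwards [ha.eventually_lt_const hδ] with N hN
    calc ‖∏ p, charFun ν (a N p) - ∏ p, charFun γ (a N p)‖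
        ≤ ∑ p, ‖charFun ν (a N p) - charFun γ (a N p)‖ :=
          norm_prod_sub_prod_le _ (fun _ _ ↦ norm_charFun_le_one _)
            fun _ _ ↦ norm_charFun_le_one _
      _ ≤ ∑ p, ε * (Var[id; ν] * (a N p * a N p)) := sum_le_sum fun p _ ↦ by
          have hp : dist (a N p) 0 < δ := by
            simpa using (norm_le_pi_norm (a N) p).trans_lt hN
          simpa [abs_of_nonneg (variance_nonneg _ _), sq] using hclose hp
      _ = ε * (Var[id; ν] * (a N ⬝ᵥ a N)) := by rw [← mul_sum, ← mul_sum, dotProduct]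
      _ ≤ ε * ‖Var[id; ν] * (a N ⬝ᵥ a N)‖ := by gcongr; exact Real.le_norm_self _
  have hlim : Tendsto (fun N ↦ ∏ p, charFun γ (a N p)) atTop (𝓝 (Complex.exp (-s / 2))) := by
    simp only [hgauss]
    exact (Complex.continuous_exp.tendsto _).comp
      ((hs.ofReal.neg).div_const 2)
  simpa using ((Asymptotics.isLittleO_one_iff ℝ).1
    (hdiff.trans_isBigO (hs.isBigO_one ℝ))).add hlim

end CharFun

section LinearForm

variable {ι κ Ω : Type*} [Fintype ι] [Fintype κ] [MeasurableSpace Ω] {P : Measure Ω}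
  {ν : Measure ℝ} {η : ι → Ω → ℝ}

lemma aemeasurable_dotProduct (hlaw : ∀ p, HasLaw (η p) ν P) (w : ι → ℝ) :
    AEMeasurable (fun ω ↦ w ⬝ᵥ (η · ω)) P :=
  Finset.aemeasurable_fun_sum _ fun p _ ↦ (hlaw p).aemeasurable.const_mul (w p)

lemma charFun_map_dotProduct (hlaw : ∀ p, HasLaw (η p) ν P)
    (hindep : iIndepFun η P) (w : ι → ℝ) :
    charFun (P.map fun ω ↦ w ⬝ᵥ (η · ω)) 1 = ∏ p, charFun ν (w p) := by
  have hm p : AEMeasurable (η p) P := (hlaw p).aemeasurable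
  have hsum := iIndepFun.charFun_map_fun_sum_eq_prod (X := fun p ω ↦ w p * η p ω)
    (fun p ↦ (hm p).const_mul _) (hindep.comp (fun p x ↦ w p * x) fun p ↦ by fun_prop)
  simp only [dotProduct, hsum, Finset.prod_apply]
  refine prod_congr rfl fun p _ ↦ ?_
  rw [charFun_map_mul_comp (hm p), (hlaw p).map_eq, mul_one]

lemma charFun_map_toLp_dotProduct (hlaw : ∀ p, HasLaw (η p) ν P)
    (hindep : iIndepFun η P) (b : κ → ι → ℝ) (t : EuclideanSpace ℝ κ) :
    charFun (P.map fun ω ↦ WithLp.toLp 2 fun i ↦ b i ⬝ᵥ (η · ω)) t =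
      ∏ p, charFun ν ((∑ i, t i • b i) p) := by
  have hm := aemeasurable_dotProduct hlaw
  rw [← charFun_map_dotProduct hlaw hindep, charFun_apply, charFun_apply_real,
    integral_map (by fun_prop) (by fun_prop), integral_map (hm _) (by fun_prop)]
  simp [PiLp.inner_apply, sum_dotProduct, mul_comm]

end LinearForm

section CentralLimit

variable {ι : ℕ → Type*} [∀ N, Fintype (ι N)] {κ : Type*} [Fintype κ]
  {Ω : ℕ → Type*} [∀ N, MeasurableSpace (Ω N)] {P : ∀ N, Measure (Ω N)}
  [∀ N, IsProbabilityMeasure (P N)] {ν : Measure ℝ} [IsProbabilityMeasure ν]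
  {η : ∀ N, ι N → Ω N → ℝ}

lemma charFun_pi_gaussianReal_zero (v : κ → ℝ≥0) (t : EuclideanSpace ℝ κ) :
    charFun ((Measure.pi fun i ↦ gaussianReal 0 (v i)).map (WithLp.toLp 2)) t =
      Complex.exp (-(∑ i, v i * t i ^ 2 : ℝ) / 2) := by
  simp only [charFun_pi, charFun_gaussianReal, ← Complex.exp_sum]
  congr 1
  push_cast
  rw [← sum_neg_distrib, sum_div]
  exact sum_congr rfl fun i _ ↦ by ring

lemma sum_smul_dotProduct_sum_smul {ι R : Type*} [Fintype ι] [CommSemiring R] (t : κ → R)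
    (b : κ → ι → R) :
    (∑ i, t i • b i) ⬝ᵥ (∑ i, t i • b i) = ∑ i, ∑ j, t i * t j * (b i ⬝ᵥ b j) := by
  rw [sum_dotProduct]
  simp [dotProduct_sum, mul_assoc, mul_left_comm]

/-- By Lévy's continuity theorem it suffices to treat the linear combinations
`∑ i, t i * (b N i ⬝ᵥ η N)`, which are again linear forms in the noise. -/
theorem tendstoInDistribution_dotProduct [DecidableEq κ] (hν2 : MemLp id 2 ν)
    (hν0 : ∫ x, x ∂ν = 0) (hlaw : ∀ N p, HasLaw (η N p) ν (P N))
    (hindep : ∀ N, iIndepFun (η N) (P N)) {b : ∀ N, κ → ι N → ℝ} {v : κ → ℝ≥0}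
    (hcov : ∀ i j, Tendsto (fun N ↦ Var[id; ν] * (b N i ⬝ᵥ b N j)) atTop
      (𝓝 (if i = j then (v i : ℝ) else 0)))
    (hb : ∀ i, Tendsto (fun N ↦ ‖b N i‖) atTop (𝓝 0)) :
    TendstoInDistribution (fun N ω i ↦ b N i ⬝ᵥ (η N · ω)) atTop (id : (κ → ℝ) → (κ → ℝ)) P
      (Measure.pi fun i ↦ gaussianReal 0 (v i)) := by
  have hm N := aemeasurable_dotProduct (hlaw N)
  suffices TendstoInDistribution (fun N ω ↦ WithLp.toLp 2 fun i ↦ b N i ⬝ᵥ (η N · ω)) atTop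
      (WithLp.toLp 2 : (κ → ℝ) → EuclideanSpace ℝ κ) P (Measure.pi fun i ↦ gaussianReal 0 (v i))
    from this.continuous_comp (PiLp.continuous_ofLp 2 _)
  refine ⟨fun N ↦ by fun_prop, by fun_prop,
    ProbabilityMeasure.tendsto_iff_tendsto_charFun.2 fun t ↦ ?_⟩
  simp only [ProbabilityMeasure.coe_mk, charFun_pi_gaussianReal_zero,
    charFun_map_toLp_dotProduct (hlaw _) (hindep _)]
  refine tendsto_prod_charFun hν2 hν0 ?_ ?_
  · have hlim : ∑ i, v i * t i ^ 2 = ∑ i, ∑ j, t i * t j * (if i = j then (v i : ℝ) else 0) := by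
      simp [sq, mul_comm]
    simp only [hlim, sum_smul_dotProduct_sum_smul, mul_sum, mul_left_comm Var[id; ν]]
    exact tendsto_finsetSum _ fun i _ ↦ tendsto_finsetSum _ fun j _ ↦ (hcov i j).const_mul _
  · refine squeeze_zero (fun N ↦ norm_nonneg _) (fun N ↦ norm_sum_le _ _) ?_
    simpa [norm_smul] using tendsto_finsetSum univ fun i _ ↦ (hb i).const_mul ‖t i‖

end CentralLimit

section LinearFormMoments

variable {ι Ω : Type*} [Fintype ι] [MeasurableSpace Ω] {P : Measure Ω}
  {ν : Measure ℝ} {η : ι → Ω → ℝ}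

lemma memLp_dotProduct {p : ENNReal} (hν : MemLp id p ν) (hlaw : ∀ p, HasLaw (η p) ν P)
    (w : ι → ℝ) : MemLp (fun ω ↦ w ⬝ᵥ (η · ω)) p P :=
  memLp_finsetSum _ fun p _ ↦ (((hlaw p).identDistrib .id).memLp_iff.2 hν).const_mul (w p)

lemma integral_dotProduct (hν1 : Integrable id ν) (hlaw : ∀ p, HasLaw (η p) ν P) (w : ι → ℝ) :
    ∫ ω, w ⬝ᵥ (η · ω) ∂P = (∑ p, w p) * ∫ x, x ∂ν := by
  simp only [dotProduct]
  rw [integral_finsetSum, sum_mul]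
  · exact sum_congr rfl fun p _ ↦ by rw [integral_const_mul, (hlaw p).integral_eq]
  · exact fun p _ ↦ (((hlaw p).identDistrib .id).integrable_iff.2 hν1).const_mul _

lemma variance_dotProduct (hν2 : MemLp id 2 ν) (hlaw : ∀ p, HasLaw (η p) ν P)
    (hindep : iIndepFun η P) (w : ι → ℝ) :
    Var[fun ω ↦ w ⬝ᵥ (η · ω); P] = Var[id; ν] * (w ⬝ᵥ w) := by
  have hsum : (fun ω ↦ w ⬝ᵥ (η · ω)) = ∑ p, fun ω ↦ w p * η p ω := by
    ext ω; simp [dotProduct]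
  rw [hsum, IndepFun.variance_sum, dotProduct, mul_sum]
  · refine sum_congr rfl fun p _ ↦ ?_
    rw [variance_const_mul, (hlaw p).variance_eq]
    ring
  · exact fun p _ ↦ (((hlaw p).identDistrib .id).memLp_iff.2 hν2).const_mul (w p)
  · exact fun p _ q _ hpq ↦ (hindep.indepFun hpq).comp (measurable_const_mul _)
      (measurable_const_mul _)

lemma standardize_dotProduct (hν1 : Integrable id ν) (hν0 : ∫ x, x ∂ν = 0)
    (hlaw : ∀ p, HasLaw (η p) ν P) (w : ι → ℝ) (ω : Ω) :
    standardize P (fun ω ↦ w ⬝ᵥ (η · ω)) ω =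
      ((√Var[fun ω ↦ w ⬝ᵥ (η · ω); P])⁻¹ • w) ⬝ᵥ (η · ω) := by
  rw [standardize, integral_dotProduct hν1 hlaw, hν0, mul_zero, sub_zero, smul_dotProduct,
    smul_eq_mul, div_eq_inv_mul]

lemma norm_inv_sqrt_smul_le {V C : ℝ} (hV : 0 ≤ V) {w : ι → ℝ}
    (hw : ∀ p, w p ^ 2 ≤ C * (w ⬝ᵥ w)) :
    ‖(√(V * (w ⬝ᵥ w)))⁻¹ • w‖ ≤ √(C / V) := by
  rcases eq_or_ne (V * (w ⬝ᵥ w)) 0 with h0 | h0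
  · simp [h0]
  · have hww : 0 ≤ w ⬝ᵥ w := sum_nonneg fun p _ ↦ mul_self_nonneg (w p)
    refine (pi_norm_le_iff_of_nonneg (Real.sqrt_nonneg _)).2 fun p ↦ Real.abs_le_sqrt ?_
    rw [Pi.smul_apply, smul_eq_mul, mul_pow, inv_pow, Real.sq_sqrt (mul_nonneg hV hww)]
    calc (V * (w ⬝ᵥ w))⁻¹ * w p ^ 2 ≤ (V * (w ⬝ᵥ w))⁻¹ * (C * (w ⬝ᵥ w)) := by
          gcongr
          exact hw p
      _ = C / V := by
          have := left_ne_zero_of_mul h0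
          have := right_ne_zero_of_mul h0
          field_simp

end LinearFormMoments

section SelfNormalized

variable {ι : ℕ → Type*} [∀ N, Fintype (ι N)] {κ : Type*} [Fintype κ]
  {Ω : ℕ → Type*} [∀ N, MeasurableSpace (Ω N)] {P : ∀ N, Measure (Ω N)}
  [∀ N, IsProbabilityMeasure (P N)] {ν : Measure ℝ} [IsProbabilityMeasure ν]
  {η : ∀ N, ι N → Ω N → ℝ}

theorem tendstoInDistribution_standardize_dotProduct [DecidableEq κ] (hν2 : MemLp id 2 ν)
    (hν0 : ∫ x, x ∂ν = 0) (hlaw : ∀ N p, HasLaw (η N p) ν (P N))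
    (hindep : ∀ N, iIndepFun (η N) (P N)) {w : ∀ N, κ → ι N → ℝ} {D : Finset κ} {C : ℕ → ℝ}
    (horth : ∀ᶠ N in atTop, Pairwise fun i j ↦ w N i ⬝ᵥ w N j = 0)
    (hD : ∀ᶠ N in atTop, ∀ i, i ∈ D ↔ Var[fun ω ↦ w N i ⬝ᵥ (η N · ω); P N] ≠ 0)
    (hC : Tendsto C atTop (𝓝 0)) (hw : ∀ N i p, w N i p ^ 2 ≤ C N * (w N i ⬝ᵥ w N i)) :
    TendstoInDistribution
      (fun N ω i ↦ standardize (P N) (fun ω ↦ w N i ⬝ᵥ (η N · ω)) ω) atTop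
      (id : (κ → ℝ) → (κ → ℝ)) P
      (Measure.pi fun i ↦ gaussianReal 0 (if i ∈ D then (1 : ℝ≥0) else 0)) := by
  simp only [standardize_dotProduct (hν2.integrable one_le_two) hν0 (hlaw _)]
  refine tendstoInDistribution_dotProduct hν2 hν0 hlaw hindep (fun i j ↦ ?_) fun i ↦ ?_
  · refine tendsto_const_nhds.congr' ?_
    filter_upwards [horth, hD] with N hN hDN
    rw [smul_dotProduct, dotProduct_smul, smul_eq_mul, smul_eq_mul]
    split_ifs with hij hi
    · have hvar := (hDN i).1 hi
      have hsq := Real.sq_sqrt (variance_nonneg (fun ω ↦ w N i ⬝ᵥ (η N · ω)) (P N))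
      rw [← hij]
      calc (1 : ℝ≥0) = Var[fun ω ↦ w N i ⬝ᵥ (η N · ω); P N] /
              √Var[fun ω ↦ w N i ⬝ᵥ (η N · ω); P N] ^ 2 := by
            rw [hsq, div_self hvar, NNReal.coe_one]
        _ = Var[id; ν] * ((√Var[fun ω ↦ w N i ⬝ᵥ (η N · ω); P N])⁻¹ *
              ((√Var[fun ω ↦ w N i ⬝ᵥ (η N · ω); P N])⁻¹ * (w N i ⬝ᵥ w N i))) := by
            nth_rw 1 [variance_dotProduct hν2 (hlaw N) (hindep N)]
            ring
    · simp [← hij, not_not.1 (mt (hDN i).2 hi)]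
    · simp [hN hij]
  · simp only [variance_dotProduct hν2 (hlaw _) (hindep _)]
    refine squeeze_zero (fun N ↦ norm_nonneg _)
      (fun N ↦ norm_inv_sqrt_smul_le (variance_nonneg _ _) (hw N i)) ?_
    simpa using (hC.div_const Var[id; ν]).sqrt

end SelfNormalized

lemma tendstoInDistribution_eval {κ : Type*} [Fintype κ] {E : κ → Type*}
    [∀ i, TopologicalSpace (E i)] [∀ i, MeasurableSpace (E i)] [∀ i, BorelSpace (E i)]
    [∀ i, SecondCountableTopology (E i)]
    {ι : Type*} {l : Filter ι} {Ω : ι → Type*} [∀ n, MeasurableSpace (Ω n)]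
    {P : ∀ n, Measure (Ω n)} [∀ n, IsProbabilityMeasure (P n)]
    {X : ∀ n, Ω n → ∀ i, E i} {μ : ∀ i, Measure (E i)} [∀ i, IsProbabilityMeasure (μ i)]
    (hX : TendstoInDistribution X l id P (Measure.pi μ)) (i : κ) :
    TendstoInDistribution (fun n ω ↦ X n ω i) l id P (μ i) := by
  have hcomp := hX.continuous_comp (continuous_apply i)
  refine ⟨hcomp.forall_aemeasurable, aemeasurable_id, ?_⟩
  have hmap := (measurePreserving_eval μ i).map_eq
  have htendsto := hcomp.tendsto
  simpa [Function.eval, Function.comp_def, hmap] using htendsto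

section PlaneWave

variable {G : Type*} [AddCommGroup G] [Fintype G]

/-- The real plane wave `p ↦ Re (z ψ(p))` with complex amplitude `z` along the character `ψ`.
Real Fourier coefficients are linear forms with such weights. -/
noncomputable def planeWave (z : ℂ) (ψ : AddChar G ℂ) (p : G) : ℝ := (z * ψ p).re

lemma sum_conv_mul_addChar {R : Type*} [CommSemiring R] (f g : G → R) (ψ : AddChar G R) :
    ∑ p, (∑ q, f q * g (p - q)) * ψ p = (∑ q, f q * ψ q) * ∑ p, g p * ψ p := by
  simp only [sum_mul]
  rw [sum_comm]
  refine sum_congr rfl fun q _ ↦ ?_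
  rw [← Equiv.sum_comp (Equiv.addRight q), mul_sum]
  refine sum_congr rfl fun p _ ↦ ?_
  rw [Equiv.coe_addRight, add_sub_cancel_right, AddChar.map_add_eq_mul]
  ring

lemma re_sum_mul_addChar [DecidableEq (AddChar G ℂ)] (z : ℂ) (ψ : AddChar G ℂ) :
    ∑ p, (z * ψ p).re = if ψ = 0 then Fintype.card G * z.re else 0 := by
  rw [← Complex.re_sum, ← mul_sum, AddChar.sum_eq_ite]
  split_ifs <;> simp [mul_comm]

lemma planeWave_dotProduct_planeWave [DecidableEq (AddChar G ℂ)] (z w : ℂ)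
    (ψ φ : AddChar G ℂ) :
    planeWave z ψ ⬝ᵥ planeWave w φ = Fintype.card G / 2 *
      ((if ψ = φ then (z * conj w).re else 0) + if ψ = -φ then (z * w).re else 0) := by
  have hterm p : planeWave z ψ p * planeWave w φ p =
      (((z * conj w) * (ψ - φ) p).re + ((z * w) * (ψ + φ) p).re) / 2 := by
    rw [sub_eq_add_neg, AddChar.add_apply, AddChar.add_apply, AddChar.neg_apply,
      AddChar.map_neg_eq_conj, planeWave, planeWave]
    simp only [Complex.mul_re, Complex.mul_im, Complex.conj_re, Complex.conj_im]
    ring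
  simp only [dotProduct, hterm]
  rw [← sum_div, sum_add_distrib, re_sum_mul_addChar, re_sum_mul_addChar]
  simp only [sub_eq_zero, ← eq_neg_iff_add_eq_zero]
  split_ifs <;> ring

lemma planeWave_dotProduct_self_of_eq_neg {ψ : AddChar G ℂ} (hψ : ψ = -ψ) (z : ℂ) :
    planeWave z ψ ⬝ᵥ planeWave z ψ = Fintype.card G * z.re ^ 2 := by
  classical
  rw [planeWave_dotProduct_planeWave, if_pos rfl, if_pos hψ]
  simp only [Complex.mul_re, Complex.conj_re, Complex.conj_im]
  ring

lemma planeWave_dotProduct_self_of_ne_neg {ψ : AddChar G ℂ} (hψ : ψ ≠ -ψ) (z : ℂ) :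
    planeWave z ψ ⬝ᵥ planeWave z ψ = Fintype.card G / 2 * ‖z‖ ^ 2 := by
  classical
  rw [planeWave_dotProduct_planeWave, if_pos rfl, if_neg hψ, add_zero, Complex.mul_conj,
    Complex.ofReal_re, Complex.normSq_eq_norm_sq]

lemma planeWave_sq_le (z : ℂ) (ψ : AddChar G ℂ) (p : G) :
    planeWave z ψ p ^ 2 ≤ 2 / Fintype.card G * (planeWave z ψ ⬝ᵥ planeWave z ψ) := by
  have hcard : (Fintype.card G : ℝ) ≠ 0 := Nat.cast_ne_zero.2 Fintype.card_ne_zero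
  by_cases hψ : ψ = -ψ
  · have hconj : conj (ψ p) = ψ p := by
      rw [← AddChar.map_neg_eq_conj, ← AddChar.neg_apply, ← hψ]
    have him : (ψ p).im = 0 := Complex.conj_eq_iff_im.1 hconj
    have hsq : (ψ p).re ^ 2 = 1 := by
      have hnorm := Complex.sq_norm (ψ p)
      rw [AddChar.norm_apply, Complex.normSq_apply, him] at hnorm
      linarith
    rw [planeWave_dotProduct_self_of_eq_neg hψ, planeWave, Complex.mul_re, him, mul_zero, sub_zero,
      mul_pow, hsq]
    field_simp
    linarith [sq_nonneg z.re]
  · have hle : planeWave z ψ p ^ 2 ≤ ‖z‖ ^ 2 := by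
      rw [sq_le_sq, abs_norm, planeWave]
      simpa only [norm_mul, AddChar.norm_apply, mul_one] using Complex.abs_re_le_norm (z * ψ p)
    rw [planeWave_dotProduct_self_of_ne_neg hψ]
    field_simp
    exact hle

end PlaneWave

section Image

variable {U V : ℕ} [NeZero U] [NeZero V]

lemma finEquiv_eq_intCast {n : ℕ} [NeZero n] (k : Fin n) :
    ZMod.finEquiv n k = ((k : ℤ) : ZMod n) := by
  cases n with
  | zero => exact k.elim0
  | succ n => rw [Int.cast_natCast]; exact (Fin.cast_val_eq_self k).symm

/-- The character `p ↦ exp (-2πi (f₁ p₁ / U + f₂ p₂ / V))` of frequency `f`. -/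
noncomputable def fourierChar (f : Fin U × Fin V) : AddChar (Fin U × Fin V) ℂ where
  toFun p := ZMod.stdAddChar (-(ZMod.finEquiv U f.1 * ZMod.finEquiv U p.1)) *
    ZMod.stdAddChar (-(ZMod.finEquiv V f.2 * ZMod.finEquiv V p.2))
  map_zero_eq_one' := by simp
  map_add_eq_mul' p q := by
    simp only [Prod.fst_add, Prod.snd_add, map_add, mul_add, neg_add, AddChar.map_add_eq_mul]
    ring

lemma fourierChar_apply (f p : Fin U × Fin V) :
    fourierChar f p = Complex.exp (-(Complex.I * (2 * (Real.pi : ℂ) *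
      ((f.1 : ℂ) * (p.1 : ℂ) / (U : ℂ) + (f.2 : ℂ) * (p.2 : ℂ) / (V : ℂ))))) := by
  simp only [fourierChar, AddChar.coe_mk, finEquiv_eq_intCast, ← Int.cast_mul, ← Int.cast_neg,
    ZMod.stdAddChar_coe, ← Complex.exp_add]
  congr 1
  push_cast
  ring

lemma fourierChar_neg (f : Fin U × Fin V) : fourierChar (-f) = -fourierChar f := by
  ext p
  simp [fourierChar]

lemma fourierChar_injective :
    Function.Injective (fourierChar : Fin U × Fin V → AddChar (Fin U × Fin V) ℂ) := by
  intro f g hfg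
  have h1 := DFunLike.congr_fun hfg (1, 0)
  have h2 := DFunLike.congr_fun hfg (0, 1)
  exact Prod.ext (by simpa [fourierChar, ZMod.injective_stdAddChar.eq_iff] using h1)
    (by simpa [fourierChar, ZMod.injective_stdAddChar.eq_iff] using h2)

end Image

section Coefficient

variable {U V : ℕ}

/-- The factor turning a real coefficient into a real part: `Im z = Re (-i z)`. -/
def Part.phase : Part → ℂ
  | re => 1
  | im => -Complex.I

/-- The frequency `[k, l]` as an element of the group of positions modulo `(U, V)`. -/
def CoeffIndex.freq (c : CoeffIndex U V) : Fin U × Fin V := (c.k, c.l)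

/-- The amplitude of the plane wave whose values are the weights of the noise in the
coefficient `c` of `h * η`. -/
noncomputable def amplitude (h : Image U V) (c : CoeffIndex U V) : ℂ :=
  c.part.phase * dft h c.k c.l

lemma coeff_eq_re_phase_mul (x : Image U V) (c : CoeffIndex U V) :
    coeff x c = (c.part.phase * dft x c.k c.l).re := by
  rcases c with ⟨k, l, _ | _⟩ <;> simp [coeff, Part.phase]

lemma norm_amplitude (h : Image U V) (c : CoeffIndex U V) :
    ‖amplitude h c‖ = ‖dft h c.k c.l‖ := by
  rcases c with ⟨k, l, _ | _⟩ <;> simp [amplitude, Part.phase]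

variable [NeZero U] [NeZero V]

lemma dft_eq_sum_fourierChar (x : Image U V) (k : Fin U) (l : Fin V) :
    dft x k l = 1 / (U * V) * ∑ p, x p * fourierChar (k, l) p := by
  simp only [dft, fourierChar_apply, Fintype.sum_prod_type]

lemma dft_conv (h x : Image U V) (k : Fin U) (l : Fin V) :
    dft (conv h x) k l = dft h k l * ∑ p, x p * fourierChar (k, l) p := by
  simp only [dft_eq_sum_fourierChar, conv, Complex.ofReal_sum, Complex.ofReal_mul]
  rw [sum_conv_mul_addChar (fun p ↦ (h p : ℂ)) (fun p ↦ (x p : ℂ)), mul_assoc]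

lemma dft_neg (x : Image U V) (k : Fin U) (l : Fin V) : dft x (-k) (-l) = conj (dft x k l) := by
  simp only [dft_eq_sum_fourierChar, ← Prod.neg_mk, fourierChar_neg, AddChar.neg_apply,
    AddChar.map_neg_eq_conj, map_mul, map_sum, map_div₀, map_one, map_natCast, Complex.conj_ofReal]

lemma noiseCoeff_eq_dotProduct {Ω : Type*} (h : Image U V) (η : Fin U × Fin V → Ω → ℝ)
    (c : CoeffIndex U V) :
    noiseCoeff h η c = fun ω ↦ planeWave (amplitude h c) (fourierChar c.freq) ⬝ᵥ (η · ω) := by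
  ext ω
  rw [noiseCoeff, coeff_eq_re_phase_mul, dft_conv, ← mul_assoc, mul_sum, Complex.re_sum]
  refine sum_congr rfl fun p _ ↦ ?_
  rw [planeWave, ← Complex.re_mul_ofReal, amplitude, CoeffIndex.freq]
  congr 1
  ring

lemma fin_add_eq_zero_iff_dvd {n : ℕ} [NeZero n] (k l : Fin n) :
    k + l = 0 ↔ n ∣ (k : ℕ) + l := by
  rw [Fin.ext_iff, Fin.val_add, Fin.val_zero, Nat.dvd_iff_mod_eq_zero]

lemma CoeffIndex.selfConj_iff (c : CoeffIndex U V) : c.SelfConj ↔ c.freq = -c.freq := by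
  rw [eq_neg_iff_add_eq_zero, SelfConj, two_mul, two_mul, Prod.ext_iff]
  simp only [freq, Prod.fst_add, Prod.snd_add, Prod.fst_zero, Prod.snd_zero,
    fin_add_eq_zero_iff_dvd]

lemma CoeffIndex.sameUpToConj_iff (c d : CoeffIndex U V) :
    c.SameUpToConj d ↔ c.part = d.part ∧ (c.freq = d.freq ∨ c.freq = -d.freq) := by
  rw [eq_neg_iff_add_eq_zero, SameUpToConj, Prod.ext_iff, Prod.ext_iff]
  simp only [freq, Prod.fst_add, Prod.snd_add, Prod.fst_zero, Prod.snd_zero,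
    fin_add_eq_zero_iff_dvd]

lemma dft_eq_conj_of_freq_eq_neg (x : Image U V) {c d : CoeffIndex U V} (hcd : c.freq = -d.freq) :
    dft x c.k c.l = conj (dft x d.k d.l) := by
  have hk : c.k = -d.k := congrArg Prod.fst hcd
  have hl : c.l = -d.l := congrArg Prod.snd hcd
  rw [hk, hl, dft_neg]

lemma planeWave_amplitude_dotProduct_eq_zero (h : Image U V) {c d : CoeffIndex U V}
    (hcd : ¬ c.SameUpToConj d) :
    planeWave (amplitude h c) (fourierChar c.freq) ⬝ᵥ
      planeWave (amplitude h d) (fourierChar d.freq) = 0 := by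
  classical
  rw [CoeffIndex.sameUpToConj_iff, not_and_or, not_or] at hcd
  rw [planeWave_dotProduct_planeWave]
  simp only [← fourierChar_neg, fourierChar_injective.eq_iff]
  rcases hcd with hpart | ⟨hne, hne_neg⟩
  · have hre : (c.part.phase * conj d.part.phase).re = 0 ∧
        (c.part.phase * d.part.phase).re = 0 := by
      rcases c with ⟨_, _, _ | _⟩ <;> rcases d with ⟨_, _, _ | _⟩ <;> simp_all [Part.phase]
    have heq (hf : c.freq = d.freq) : (amplitude h c * conj (amplitude h d)).re = 0 := by
      have hdft : dft h c.k c.l = dft h d.k d.l :=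
        congrArg₂ (dft h) (congrArg Prod.fst hf) (congrArg Prod.snd hf)
      rw [amplitude, amplitude, hdft, map_mul, mul_mul_mul_comm, Complex.mul_conj,
        Complex.re_mul_ofReal, hre.1, zero_mul]
    have hneg (hf : c.freq = -d.freq) : (amplitude h c * amplitude h d).re = 0 := by
      rw [amplitude, amplitude, dft_eq_conj_of_freq_eq_neg h hf, mul_mul_mul_comm,
        ← Complex.normSq_eq_conj_mul_self, Complex.re_mul_ofReal, hre.2, zero_mul]
    simp +contextual [heq, hneg]
  · rw [if_neg hne, if_neg hne_neg, add_zero, mul_zero]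

lemma planeWave_amplitude_dotProduct_self_ne_zero_iff (h : Image U V) (c : CoeffIndex U V) :
    planeWave (amplitude h c) (fourierChar c.freq) ⬝ᵥ
      planeWave (amplitude h c) (fourierChar c.freq) ≠ 0 ↔
    dft h c.k c.l ≠ 0 ∧ ¬ (c.part = Part.im ∧ c.SelfConj) := by
  by_cases hc : c.SelfConj
  · have hfreq := c.selfConj_iff.1 hc
    have him : (dft h c.k c.l).im = 0 :=
      Complex.conj_eq_iff_im.1 (dft_eq_conj_of_freq_eq_neg h hfreq).symm
    rw [planeWave_dotProduct_self_of_eq_neg (by rw [← fourierChar_neg, ← hfreq])]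
    rcases c with ⟨k, l, _ | _⟩ <;>
      simp_all [amplitude, Part.phase, Complex.ext_iff, NeZero.ne]
  · have hfreq : fourierChar c.freq ≠ -fourierChar c.freq := by
      rwa [← fourierChar_neg, fourierChar_injective.ne_iff, ne_eq, ← c.selfConj_iff]
    rw [planeWave_dotProduct_self_of_ne_neg hfreq, norm_amplitude]
    simp [hc, NeZero.ne]

end Coefficient

section Noise

variable {ν : Measure ℝ}

section Moments

variable {U V : ℕ} [NeZero U] [NeZero V] {Ω : Type*} [MeasurableSpace Ω] {P : Measure Ω}
  {η : Fin U × Fin V → Ω → ℝ}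

lemma variance_noiseCoeff_ne_zero_iff (hν2 : MemLp id 2 ν) (hlaw : ∀ p, HasLaw (η p) ν P)
    (hindep : iIndepFun η P) (h : Image U V) (c : CoeffIndex U V) :
    Var[noiseCoeff h η c; P] ≠ 0 ↔
      Var[id; ν] ≠ 0 ∧ dft h c.k c.l ≠ 0 ∧ ¬ (c.part = Part.im ∧ c.SelfConj) := by
  rw [noiseCoeff_eq_dotProduct, variance_dotProduct hν2 hlaw hindep, mul_ne_zero_iff,
    planeWave_amplitude_dotProduct_self_ne_zero_iff]

lemma noiseCoeff_ae_eq_zero [IsProbabilityMeasure ν] [IsProbabilityMeasure P]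
    (hν2 : MemLp id 2 ν) (hν0 : ∫ x, x ∂ν = 0) (hlaw : ∀ p, HasLaw (η p) ν P) (h : Image U V)
    (c : CoeffIndex U V) (hvar : Var[noiseCoeff h η c; P] = 0) : noiseCoeff h η c =ᵐ[P] 0 := by
  rw [noiseCoeff_eq_dotProduct] at hvar ⊢
  have hmean : ∫ ω, planeWave (amplitude h c) (fourierChar c.freq) ⬝ᵥ (η · ω) ∂P = 0 := by
    rw [integral_dotProduct (hν2.integrable one_le_two) hlaw, hν0, mul_zero]
  have hconst := ae_eq_integral_of_variance_eq_zero (memLp_dotProduct hν2 hlaw _) hvar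
  rwa [hmean] at hconst

end Moments

theorem tendstoInDistribution_standardize_noiseCoeff [IsProbabilityMeasure ν]
    (hν2 : MemLp id 2 ν) (hν0 : ∫ x, x ∂ν = 0) {U V : ℕ → ℕ} [∀ N, NeZero (U N)]
    [∀ N, NeZero (V N)] (hUV : Tendsto (fun N ↦ U N * V N) atTop atTop)
    {Ω : ℕ → Type*} [∀ N, MeasurableSpace (Ω N)] {P : ∀ N, Measure (Ω N)}
    [∀ N, IsProbabilityMeasure (P N)] {η : ∀ N, Fin (U N) × Fin (V N) → Ω N → ℝ}
    (hlaw : ∀ N p, HasLaw (η N p) ν (P N)) (hindep : ∀ N, iIndepFun (η N) (P N))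
    (h : ∀ N, Image (U N) (V N)) {κ : Type*} [Fintype κ] [DecidableEq κ]
    {c : κ → ∀ N, CoeffIndex (U N) (V N)} {D : Finset κ}
    (hc : ∀ᶠ N in atTop, ∀ i j, i ≠ j → ¬ (c i N).SameUpToConj (c j N))
    (hD : ∀ᶠ N in atTop, ∀ i, i ∈ D ↔ Var[noiseCoeff (h N) (η N) (c i N); P N] ≠ 0) :
    TendstoInDistribution
      (fun N ω i ↦ standardize (P N) (noiseCoeff (h N) (η N) (c i N)) ω) atTop
      (id : (κ → ℝ) → (κ → ℝ)) P
      (Measure.pi fun i ↦ gaussianReal 0 (if i ∈ D then (1 : ℝ≥0) else 0)) := by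
  have hsize : Tendsto (fun N ↦ 2 / (Fintype.card (Fin (U N) × Fin (V N)) : ℝ)) atTop (𝓝 0) := by
    simp only [Fintype.card_prod, Fintype.card_fin]
    exact (tendsto_natCast_atTop_atTop.comp hUV).const_div_atTop 2
  simp only [noiseCoeff_eq_dotProduct] at hD ⊢
  refine tendstoInDistribution_standardize_dotProduct hν2 hν0 hlaw hindep ?_ hD hsize
    fun N i p ↦ planeWave_sq_le _ _ p
  filter_upwards [hc] with N hN i j hij
  exact planeWave_amplitude_dotProduct_eq_zero (h N) (hN i j hij)

end Noise

end FourierNoise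

theorem theorem2
    -- image sizes `U N × V N` with `U V → ∞`
    (U V : ℕ → ℕ) (hU : ∀ N, 0 < U N) (hV : ∀ N, 0 < V N)
    (hUV : Tendsto (fun N => U N * V N) atTop atTop)
    -- the correlation kernels
    (h : ∀ N, FourierNoise.Image (U N) (V N))
    -- the common law of the i.i.d. noise: mean zero, finite variance
    (ν : Measure ℝ) [IsProbabilityMeasure ν] (hν2 : MemLp id 2 ν) (hν0 : ∫ x, x ∂ν = 0)
    -- the i.i.d. noise
    {Ω : ℕ → Type*} [∀ N, MeasurableSpace (Ω N)]
    (P : ∀ N, Measure (Ω N)) [∀ N, IsProbabilityMeasure (P N)]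
    (η : ∀ N, Fin (U N) × Fin (V N) → Ω N → ℝ)
    (hlaw : ∀ N p, HasLaw (η N p) ν (P N))
    (hindep : ∀ N, iIndepFun (η N) (P N)) :
    -- which coefficients are degenerate; those vanish almost surely
    (∀ N (c : FourierNoise.CoeffIndex (U N) (V N)),
      (variance (FourierNoise.noiseCoeff (h N) (η N) c) (P N) ≠ 0 ↔
        variance id ν ≠ 0 ∧ FourierNoise.dft (h N) c.k c.l ≠ 0 ∧
          ¬ (c.part = FourierNoise.Part.im ∧ c.SelfConj)) ∧
      (variance (FourierNoise.noiseCoeff (h N) (η N) c) (P N) = 0 →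
        FourierNoise.noiseCoeff (h N) (η N) c =ᵐ[P N] 0)) ∧
    -- (i) each coefficient is asymptotically Gaussian
    (∀ c : ∀ N, FourierNoise.CoeffIndex (U N) (V N),
      (∀ᶠ N in atTop, variance (FourierNoise.noiseCoeff (h N) (η N) (c N)) (P N) ≠ 0) →
      TendstoInDistribution
        (fun N => FourierNoise.standardize (P N) (FourierNoise.noiseCoeff (h N) (η N) (c N)))
        atTop (id : ℝ → ℝ) P (gaussianReal 0 1)) ∧
    -- (ii) finitely many different coefficients are asymptotically independent:
    -- their joint law converges to a product of (possibly degenerate) Gaussian laws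
    (∀ (m : ℕ) (c : Fin m → ∀ N, FourierNoise.CoeffIndex (U N) (V N)) (D : Finset (Fin m)),
      (∀ᶠ N in atTop, ∀ i j, i ≠ j → ¬ (c i N).SameUpToConj (c j N)) →
      (∀ᶠ N in atTop, ∀ i,
        (i ∈ D ↔ variance (FourierNoise.noiseCoeff (h N) (η N) (c i N)) (P N) ≠ 0)) →
      TendstoInDistribution
        (fun N ω i =>
          FourierNoise.standardize (P N) (FourierNoise.noiseCoeff (h N) (η N) (c i N)) ω)
        atTop (id : (Fin m → ℝ) → (Fin m → ℝ)) P
        (Measure.pi (fun i => gaussianReal 0 (if i ∈ D then (1 : ℝ≥0) else 0)))) := by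
  have (N : ℕ) : NeZero (U N) := ⟨(hU N).ne'⟩
  have (N : ℕ) : NeZero (V N) := ⟨(hV N).ne'⟩
  refine ⟨fun N c ↦ ⟨?_, ?_⟩, fun c hc ↦ ?_, fun m c D hc hD ↦ ?_⟩
  · exact FourierNoise.variance_noiseCoeff_ne_zero_iff hν2 (hlaw N) (hindep N) (h N) c
  · exact FourierNoise.noiseCoeff_ae_eq_zero hν2 hν0 (hlaw N) (h N) c
  · have hjoint := FourierNoise.tendstoInDistribution_standardize_noiseCoeff hν2 hν0 hUV hlaw
      hindep h (c := fun _ : Unit ↦ c) (D := Finset.univ)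
      (.of_forall fun N i j hij ↦ absurd (Subsingleton.elim i j) hij)
      (hc.mono fun N hN _ ↦ iff_of_true (Finset.mem_univ _) hN)
    simpa using FourierNoise.tendstoInDistribution_eval hjoint ()
  · exact FourierNoise.tendstoInDistribution_standardize_noiseCoeff hν2 hν0 hUV hlaw hindep h hc hD
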